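/- Let $H$ be a real Hilbert space, $d\ge 1$ an integer, and $C\subseteq H$ a bounded closed convex set with $\operatorname{diam} C\le d$. Let $T:C\to C$ be nonexpansive and $G:C\to C$ a $\tau$-contraction, i.e. $\|Gx-Gy\|\le\tau\|x-y\|$, with $0<\tau<1$. Let $(\lambda_n)_{n\ge 0}\subset(0,1]$, let $h:\mathbb N\to\mathbb N\setminus\{0\}$ satisfy $\lambda_n\ge 1/h(n)$ for all $n$, let $\chi:\mathbb N\to\mathbb N$ satisfy $\lambda_i\le\frac1{n+1}$ for all $n$ and all $i\ge\chi(n)$, and let $\phi_1,\phi_2:(0,\infty)\to\mathbb N$ satisfy $$\sum_{i=1}^{\phi_1(k)}\lambda_i\ge k\quad(k>0),\qquad \frac{|\lambda_n-\lambda_{n+1}|}{\lambda_{n+1}^2}\le\eta\quad(\eta>0,\ n\ge\phi_2(\eta)).$$ Let $u_0\in C$ and $u_{n+1}=(1-\lambda_{n+1})Tu_n+\lambda_{n+1}GTu_n$. Definition of the bound. For $\varepsilon\in(0,1]$ and $g:\mathbb N\to\mathbb N$ put $\tilde g(n)=\max\{n,g(n)\}$, $$\varepsilon_d=\frac{(1-\tau)^2(\varepsilon/2)^4}{8d^2},\quad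 \tilde\varepsilon=\frac{(1-\tau)^2}{6+8d}\,\varepsilon_d,\quad N=\Big\lceil\frac{8d^4}{\tilde\varepsilon^4}\Big\rceil,\quad i_0=\Big\lceil\log_\tau\frac{\tilde\varepsilon}{6d^2}-1\Big\rceil,$$ $$f(n)=\Big\lceil\frac{6d\,h^M(\tilde g^M(\chi(dn)))}{(1-\tau)(\varepsilon/2)^2}\Big\rceil\quad(n\ge 1).$$ Here $F^M(n)$ is the maximum of $F(i)$ over all $i\le n$ in the domain of $F$ (which is $i\ge0$ for $h,\tilde g$, and $i\ge1$ for $f$ and the functions $f_i$ below). For $F:\mathbb N\setminus\{0\}\to\mathbb N\setminus\{0\}$ let $\tilde F(n)=\max\{F^M(16dn^2),16dn^2\}$. With $F^{(m)}$ denoting the $m$-fold iterate, put $f_i=\tilde f^{(N^i)}$, $k_0=\tilde f_0^{(N)}(1)$, $k_{i+1}=\tilde f_i^{(N)}(k_i)$. Write $K(\varepsilon,g,\chi,h,d)=k_{i_0}$ and $\Xi(\varepsilon,g,\chi,h,d)=\chi(d\cdot k_{i_0})$. Theorem. Let $\varepsilon\in(0,1]$ and $g:\mathbb N\to\mathbb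 N$, and set $$\delta=\frac{\varepsilon}{2d(2+\tau)},\quad c=\phi_1\!\left(\frac{\phi_2\big(\frac{(1-\tau)^2\delta}{6d}\big)+\log\frac{6d}{\delta}}{1-\tau}\right),\quad g_c(n)=n+c+g(n+c),\quad \varepsilon'=\frac1{K(\delta/6,g_c,\chi,h,d)}.$$ Then $\varepsilon'>0$ and there is an $n\le\Xi(\delta/6,g_c,\chi,h,d)+c$ such that (i) $\|u_i-u_j\|\le\varepsilon$ for all $i,j\in[n,n+g(n)]$, and (ii) every $x\in C$ with $\|Tx-x\|\le\varepsilon'$ satisfies $\langle Gu_n-u_n,x-u_n\rangle\le\varepsilon$. -/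

import Mathlib

namespace HSDM

/-- `h^M(n) = max {h(i) : 0 ≤ i ≤ n}` for a function on the nonnegative integers. -/
def maxUpTo (h : ℕ → ℕ) (n : ℕ) : ℕ := (Finset.range (n + 1)).sup h

/-- `f^M(n) = max {f(i) : 1 ≤ i ≤ n}` for a function on the positive integers
(the value at `0` plays no role). -/
def maxFromOne (f : ℕ → ℕ) (n : ℕ) : ℕ := (Finset.Icc 1 n).sup f

/-- `g̃(n) = max {n, g(n)}`. -/
def gTilde (g : ℕ → ℕ) (n : ℕ) : ℕ := max n (g n)

/-- `ε_d = (1 - τ)² (ε/2)⁴ / (8 d²)`. -/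
noncomputable def epsD (ε τ : ℝ) (d : ℕ) : ℝ :=
  (1 - τ) ^ 2 * (ε / 2) ^ 4 / (8 * (d : ℝ) ^ 2)

/-- `ε̃ = (1 - τ)² / (6 + 8 d) · ε_d`. -/
noncomputable def epsTilde (ε τ : ℝ) (d : ℕ) : ℝ :=
  (1 - τ) ^ 2 / (6 + 8 * (d : ℝ)) * epsD ε τ d

/-- `n_ε̃ = ⌈8 d⁴ / ε̃⁴⌉`. -/
noncomputable def nTilde (ε τ : ℝ) (d : ℕ) : ℕ :=
  ⌈8 * (d : ℝ) ^ 4 / epsTilde ε τ d ^ 4⌉₊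

/-- `i₀ = ⌈log_τ (ε̃ / (6 d²)) - 1⌉`. -/
noncomputable def iZero (ε τ : ℝ) (d : ℕ) : ℕ :=
  ⌈Real.logb τ (epsTilde ε τ d / (6 * (d : ℝ) ^ 2)) - 1⌉₊

/-- `f(n) = ⌈6 d h^M(g̃^M(χ(d n))) / ((1 - τ) (ε/2)²)⌉`. -/
noncomputable def fBase (ε τ : ℝ) (g χ h : ℕ → ℕ) (d : ℕ) (n : ℕ) : ℕ :=
  ⌈6 * (d : ℝ) * (maxUpTo h (maxUpTo (gTilde g) (χ (d * n))) : ℝ)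
    / ((1 - τ) * (ε / 2) ^ 2)⌉₊

/-- `f ↦ f̃`, where `f̃(n) = max {f^M(16 d n²), 16 d n²}`. -/
def tilde (d : ℕ) (f : ℕ → ℕ) (n : ℕ) : ℕ :=
  max (maxFromOne f (16 * d * n ^ 2)) (16 * d * n ^ 2)

/-- `f_i(k) = f̃^{(N^i)}(k)`, the `N^i`-fold iterate of `f̃`. -/
def fIter (d N : ℕ) (f : ℕ → ℕ) (i : ℕ) (k : ℕ) : ℕ := (tilde d f)^[N ^ i] k

/-- `k_0 = (f_0)~^{(N)}(1)` and `k_{i+1} = (f_i)~^{(N)}(k_i)`. -/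
def kSeq (d N : ℕ) (f : ℕ → ℕ) : ℕ → ℕ
  | 0 => (tilde d (fIter d N f 0))^[N] 1
  | i + 1 => (tilde d (fIter d N f i))^[N] (kSeq d N f i)

/-- The number `k_{i₀}` belonging to `(ε, g, χ, h, d)` and `τ`. -/
noncomputable def kFinal (ε τ : ℝ) (g χ h : ℕ → ℕ) (d : ℕ) : ℕ :=
  kSeq d (nTilde ε τ d) (fBase ε τ g χ h d) (iZero ε τ d)

/-- `Ξ(ε, g, χ, h, d) = χ(d · k_{i₀})`. -/
noncomputable def Xi (ε τ : ℝ) (g χ h : ℕ → ℕ) (d : ℕ) : ℕ :=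
  χ (d * kFinal ε τ g χ h d)

/-- `δ = ε / (2 d (2 + τ))`. -/
noncomputable def delta (ε τ : ℝ) (d : ℕ) : ℝ := ε / (2 * (d : ℝ) * (2 + τ))

/-- `c = φ₁((φ₂((1 - τ)² δ / (6 d)) + log (6 d / δ)) / (1 - τ))`. -/
noncomputable def cShift (ε τ : ℝ) (φ₁ φ₂ : ℝ → ℕ) (d : ℕ) : ℕ :=
  φ₁ (((φ₂ ((1 - τ) ^ 2 * delta ε τ d / (6 * (d : ℝ))) : ℝ)
    + Real.log (6 * (d : ℝ) / delta ε τ d)) / (1 - τ))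

/-- `g_c(n) = n + c + g(n + c)`. -/
def gShift (g : ℕ → ℕ) (c : ℕ) (n : ℕ) : ℕ := n + c + g (n + c)

end HSDM

/-!
Write `S = G ∘ T`. For a parameter `t ∈ (0, 1]` let `z_t` be the fixed point in `C` of
`(1 - t) T + t S` (the viscosity curve), and for an anchor `a ∈ C` let `w_t(a)` be the fixed point
of `(1 - t) T + t a`, so that `z_t = w_t(S z_t)`.

*The iteration follows the curve.* The condition on `|λ_n - λ_{n+1}| / λ_{n+1}²` bounds
`‖z_{λ_n} - z_{λ_{n+1}}‖` by a small multiple of `λ_{n+1}`, so `‖u_n - z_{λ_n}‖` satisfies a linear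
recursive inequality, and the choice of `c` gives `‖u_n - z_{λ_n}‖ ≤ δ / 3` for all `n ≥ c`
(`norm_step_sub_le`, `le_add_exp_of_recursion`, `exp_sum_Ioc_le`).

*Metastability of the curve.* For a fixed anchor, monotonicity of `I - T` gives
`‖w_s(a) - w_t(a)‖² ≤ ‖w_s(a) - a‖² - ‖w_t(a) - a‖²` for `s ≤ t`
(`norm_anchor_sub_sq_le`). Hence among any `n ≥ d² / η²` consecutive blocks of parameters there
is one on which `w(a)` is `η`-stable (`exists_anchored_stable`). If `z` stays within `r` of a
point `p` on a block, then it stays within `τ r` of `w(S p)` there. Starting from the trivial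
radius `d` and refining the blocks `i` times by a factor `n`, one finds among `n ^ i` blocks one on
which `z` stays within `τ ^ i d + η / (1 - τ)` of a point (`exists_viscosity_stable`). For
`i = i₀ + 1` this radius is small enough (`pow_iZero_succ_mul_le`).

*The bound.* Let `m_j` be the `(j + 1)`-fold iterate of `f̃` at `1`. The number `k_{i₀}` comprises so
many iterations of `f̃` that all endpoints `1 / m_j` of the blocks needed satisfy `m_j ≤ k_{i₀}`
(`iterate_tilde_le_kSeq`, `sq_ceil_succ_le_nTilde`), and `f` grows so fast that the parameters `λ_i`
of a whole interval of indices `[n, g̃(n)]` fall into a single block (`le_fBase`). This gives (i).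

*The variational inequality.* For (ii), monotonicity of `I - T` bounds
`⟨G z_t - z_t, x - z_t⟩` by `‖T x - x‖ d / t + t d²` (`inner_viscosity_le`). Both terms are small for
`t = λ_n`, and replacing `z_{λ_n}` by `u_n` costs at most `(2 + τ) d ‖u_n - z_{λ_n}‖`
(`inner_map_sub_le`).
-/

namespace HSDM

/-! ### Growth of the iterates that define the bound -/

section Iterates

theorem le_maxUpTo (h : ℕ → ℕ) {i n : ℕ} (hi : i ≤ n) : h i ≤ maxUpTo h n :=
  Finset.le_sup (f := h) (Finset.mem_range.2 (Nat.lt_succ_of_le hi))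

theorem tilde_mono (d : ℕ) (f : ℕ → ℕ) : Monotone (tilde d f) := by
  intro a b hab
  have h : 16 * d * a ^ 2 ≤ 16 * d * b ^ 2 := by gcongr
  exact max_le_max (Finset.sup_mono (Finset.Icc_subset_Icc_right h)) h

theorem le_sixteen_mul_sq {d : ℕ} (hd : 0 < d) (n : ℕ) : n ≤ 16 * d * n ^ 2 := by
  nlinarith [Nat.le_self_pow two_ne_zero n, Nat.zero_le (n ^ 2)]

theorem le_tilde {d : ℕ} (hd : 0 < d) (f : ℕ → ℕ) (n : ℕ) : n ≤ tilde d f n :=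
  (le_sixteen_mul_sq hd n).trans (le_max_right _ _)

theorem apply_le_tilde {d : ℕ} (hd : 0 < d) (f : ℕ → ℕ) {n : ℕ} (hn : 1 ≤ n) :
    f n ≤ tilde d f n :=
  (Finset.le_sup (f := f) (Finset.mem_Icc.2 ⟨hn, le_sixteen_mul_sq hd n⟩)).trans (le_max_left _ _)

theorem iterate_tilde_mono {d : ℕ} (hd : 0 < d) (f : ℕ → ℕ) (k : ℕ) :
    Monotone fun n => (tilde d f)^[n] k :=
  fun _ _ hab => Function.monotone_iterate_of_id_le (f := tilde d f) (le_tilde hd f) hab k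

theorem iterate_le_iterate_of_pos {p q : ℕ → ℕ} (hp : Monotone p) (hid : ∀ n, n ≤ p n)
    (hpq : ∀ n, 1 ≤ n → p n ≤ q n) {k : ℕ} (hk : 1 ≤ k) (N : ℕ) : p^[N] k ≤ q^[N] k := by
  induction N with
  | zero => simp
  | succ N ih =>
    rw [Function.iterate_succ_apply', Function.iterate_succ_apply']
    have h1 : k ≤ p^[N] k := Function.id_le_iterate_of_id_le (f := p) hid N k
    exact (hp ih).trans (hpq _ (hk.trans (h1.trans ih)))

/-- The `N`-fold iterate of `(f_i)~` performs at least `N ^ i * N` steps of `f̃`. -/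
theorem iterate_tilde_le_iterate_tilde_fIter {d : ℕ} (hd : 0 < d) (N : ℕ) (f : ℕ → ℕ) (i : ℕ)
    {k : ℕ} (hk : 1 ≤ k) :
    (tilde d f)^[N ^ i * N] k ≤ (tilde d (fIter d N f i))^[N] k := by
  rw [Function.iterate_mul]
  refine iterate_le_iterate_of_pos ((tilde_mono d f).iterate _) (fun n => ?_) (fun n hn => ?_) hk N
  · exact Function.id_le_iterate_of_id_le (f := tilde d f) (le_tilde hd f) _ n
  · exact apply_le_tilde hd (fIter d N f i) hn

theorem tilde_one_le_kSeq {d : ℕ} (hd : 0 < d) {N : ℕ} (hN : 1 ≤ N) (f : ℕ → ℕ) (i : ℕ) :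
    tilde d f 1 ≤ kSeq d N f i := by
  induction i with
  | zero =>
    refine le_trans ?_ (iterate_tilde_le_iterate_tilde_fIter hd N f 0 le_rfl)
    exact iterate_tilde_mono hd f 1 (a := 1) (by simpa using hN)
  | succ i ih =>
    exact ih.trans (Function.id_le_iterate_of_id_le (f := tilde d (fIter d N f i))
      (le_tilde hd _) N _)

/-- The number `k_i` dominates `n ^ (i + 1) + 1` steps of `f̃` from `1`, as soon as
`n ^ 2 < N`. The square leaves room for one more factor `n` than there are factors `N`. -/
theorem iterate_tilde_le_kSeq {d : ℕ} (hd : 0 < d) {N n : ℕ} (hn : 1 ≤ n) (hN : n ^ 2 + 1 ≤ N)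
    (f : ℕ → ℕ) (i : ℕ) : (tilde d f)^[n ^ (i + 1) + 1] 1 ≤ kSeq d N f i := by
  cases i with
  | zero =>
    refine le_trans ?_ (iterate_tilde_le_iterate_tilde_fIter hd N f 0 le_rfl)
    apply iterate_tilde_mono hd f 1
    have := Nat.le_self_pow two_ne_zero n
    simp only [zero_add, pow_one, pow_zero, one_mul]
    omega
  | succ i =>
    have h1 := tilde_one_le_kSeq hd (N := N) (by omega) f i
    have hpos : 1 ≤ kSeq d N f i := (le_tilde hd f 1).trans h1
    refine le_trans ?_ (iterate_tilde_le_iterate_tilde_fIter hd N f i hpos)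
    refine le_trans ?_ ((tilde_mono d f).iterate _ h1)
    rw [← Function.iterate_succ_apply]
    apply iterate_tilde_mono hd f 1
    have h2 : n ^ (i + 1 + 1) ≤ N ^ i * N := calc
      n ^ (i + 1 + 1) ≤ n ^ (2 * (i + 1)) := Nat.pow_le_pow_right hn (by omega)
      _ = (n ^ 2) ^ (i + 1) := pow_mul _ _ _
      _ ≤ N ^ (i + 1) := Nat.pow_le_pow_left (by omega) _
      _ = N ^ i * N := pow_succ _ _
    omega

end Iterates

/-! ### Size of the constants -/

section Constants

variable {e τ : ℝ} {d : ℕ}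

theorem epsTilde_pos (he : 0 < e) (hτ1 : τ < 1) (hd : 0 < d) : 0 < epsTilde e τ d := by
  have : 0 < 1 - τ := by linarith
  have : (0 : ℝ) < d := by exact_mod_cast hd
  unfold epsTilde epsD
  positivity

theorem epsTilde_le (he : 0 < e) (he1 : e ≤ 1) (hτ0 : 0 < τ) (hτ1 : τ < 1) (hd : 0 < d) :
    epsTilde e τ d ≤ (1 - τ) * e / 100 := by
  have hp : 0 < 1 - τ := by linarith
  have hd1 : (1 : ℝ) ≤ d := by exact_mod_cast hd
  have h1 : (1 - τ) ^ 2 / (6 + 8 * (d : ℝ)) ≤ 1 / 14 :=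
    div_le_div₀ zero_le_one (pow_le_one₀ hp.le (by linarith)) (by norm_num) (by linarith)
  have h2 : epsD e τ d ≤ (1 - τ) * (e / 16) / 8 := by
    refine div_le_div₀ (by positivity) ?_ (by norm_num) (by nlinarith)
    have h3 : (1 - τ) ^ 2 ≤ 1 - τ := pow_le_of_le_one hp.le (by linarith) two_ne_zero
    have h4 : e ^ 4 ≤ e := pow_le_of_le_one he.le he1 (by norm_num)
    exact mul_le_mul h3 (by rw [div_pow]; linarith) (by positivity) hp.le
  have h5 : epsTilde e τ d ≤ 1 / 14 * ((1 - τ) * (e / 16) / 8) :=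
    mul_le_mul h1 h2 (by unfold epsD; positivity) (by norm_num)
  have : 0 < (1 - τ) * e := by positivity
  linarith

theorem pow_iZero_succ_mul_le (he : 0 < e) (he1 : e ≤ 1) (hτ0 : 0 < τ) (hτ1 : τ < 1)
    (hd : 0 < d) : τ ^ (iZero e τ d + 1) * d ≤ e / 4 := by
  have hd1 : (1 : ℝ) ≤ d := by exact_mod_cast hd
  have hx := epsTilde_pos he hτ1 hd
  have h1 : Real.logb τ (epsTilde e τ d / (6 * (d : ℝ) ^ 2)) ≤ ((iZero e τ d + 1 : ℕ) : ℝ) := by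
    have := Nat.le_ceil (Real.logb τ (epsTilde e τ d / (6 * (d : ℝ) ^ 2)) - 1)
    rw [Nat.cast_add_one]
    exact sub_le_iff_le_add.1 this
  rw [Real.logb_le_iff_le_rpow_of_base_lt_one hτ0 hτ1 (by positivity), Real.rpow_natCast] at h1
  have h2 : epsTilde e τ d ≤ e := by
    have := epsTilde_le he he1 hτ0 hτ1 hd
    nlinarith [mul_pos hτ0 he]
  calc τ ^ (iZero e τ d + 1) * d ≤ epsTilde e τ d / (6 * (d : ℝ) ^ 2) * d := by gcongr
    _ ≤ e / 4 := by
      rw [div_mul_eq_mul_div, div_le_div_iff₀ (by positivity) (by norm_num)]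
      nlinarith [mul_le_mul h2 hd1 zero_le_one he.le, mul_pos he (by positivity : (0:ℝ) < d),
        mul_le_mul_of_nonneg_right h2 (by positivity : (0:ℝ) ≤ d),
        mul_le_mul_of_nonneg_left hd1 (by positivity : (0:ℝ) ≤ e * d)]

theorem sq_ceil_succ_le_nTilde (he : 0 < e) (he1 : e ≤ 1) (hτ0 : 0 < τ) (hτ1 : τ < 1)
    (hd : 0 < d) : ⌈(d : ℝ) ^ 2 / ((1 - τ) * e / 4) ^ 2⌉₊ ^ 2 + 1 ≤ nTilde e τ d := by
  have hp : 0 < 1 - τ := by linarith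
  have hd1 : (1 : ℝ) ≤ d := by exact_mod_cast hd
  have hx := epsTilde_pos he hτ1 hd
  set q : ℝ := (1 - τ) * e with hq
  have hq0 : 0 < q := by positivity
  have hq1 : q ≤ 1 := mul_le_one₀ (by linarith) he.le he1
  set X : ℝ := (d : ℝ) ^ 2 / q ^ 2 with hX
  have hX1 : 1 ≤ X := by
    rw [hX, one_le_div (by positivity)]
    exact pow_le_pow_left₀ hq0.le (hq1.trans hd1) 2
  have h1 : (⌈(d : ℝ) ^ 2 / (q / 4) ^ 2⌉₊ : ℝ) ≤ 17 * X := by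
    have h2 : (d : ℝ) ^ 2 / (q / 4) ^ 2 = 16 * X := by rw [hX]; field_simp; norm_num
    have := Nat.ceil_lt_add_one (a := (d : ℝ) ^ 2 / (q / 4) ^ 2) (by positivity)
    rw [h2] at this ⊢
    linarith
  have h3 : 800000000 * X ^ 2 ≤ (nTilde e τ d : ℝ) := by
    refine le_trans ?_ (Nat.le_ceil _)
    calc 800000000 * X ^ 2 = 8 * (d : ℝ) ^ 4 / (q / 100) ^ 4 := by rw [hX]; field_simp; norm_num
      _ ≤ _ := by
        gcongr
        exact epsTilde_le he he1 hτ0 hτ1 hd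
  have h4 : ((⌈(d : ℝ) ^ 2 / (q / 4) ^ 2⌉₊ ^ 2 + 1 : ℕ) : ℝ) ≤ nTilde e τ d := by
    push_cast
    have := pow_le_pow_left₀ (Nat.cast_nonneg _) h1 2
    nlinarith
  exact_mod_cast h4

/-- The growth of `f`, on indices that are at most `g̃(n)` for some `n ≤ χ(d m)`. -/
theorem le_fBase (he : 0 < e) (hτ1 : τ < 1) (g χ h : ℕ → ℕ) {m n i : ℕ}
    (hn : n ≤ χ (d * m)) (hi : i ≤ gTilde g n) :
    6 * d * (h i : ℝ) / ((1 - τ) * (e / 2) ^ 2) ≤ fBase e τ g χ h d m := by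
  have hp : 0 < 1 - τ := by linarith
  refine le_trans ?_ (Nat.le_ceil _)
  have : (h i : ℝ) ≤ maxUpTo h (maxUpTo (gTilde g) (χ (d * m))) := by
    exact_mod_cast le_maxUpTo h (hi.trans (le_maxUpTo _ hn))
  gcongr

end Constants

/-! ### Resolvent curves and their metastability -/

section Resolvents

theorem exists_fixedPoint_of_contraction {X : Type*} [NormedAddCommGroup X] [CompleteSpace X]
    {C : Set X} (hC : IsClosed C) (hne : C.Nonempty) {f : X → X}
    (hf : Set.MapsTo f C C) {k : ℝ} (hk0 : 0 ≤ k) (hk : k < 1)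
    (hfk : ∀ x ∈ C, ∀ y ∈ C, ‖f x - f y‖ ≤ k * ‖x - y‖) : ∃ z ∈ C, z = f z := by
  obtain ⟨x, hx⟩ := hne
  have hcon : ContractingWith ⟨k, hk0⟩ (hf.restrict f C C) := by
    refine ⟨by exact_mod_cast hk, LipschitzWith.of_dist_le_mul fun a b => ?_⟩
    have := hfk a a.2 b b.2
    rwa [← dist_eq_norm, ← dist_eq_norm] at this
  obtain ⟨y, hy, hfix, -⟩ :=
    ContractingWith.exists_fixedPoint' hC.isComplete hf hcon hx (edist_ne_top _ _)
  exact ⟨y, hy, hfix.symm⟩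

variable {H : Type*} [NormedAddCommGroup H] [InnerProductSpace ℝ H]
  {C : Set H} {T S : H → H} {τ D : ℝ}

theorem exists_resolvent [CompleteSpace H] (hC : IsClosed C) (hconv : Convex ℝ C)
    (hne : C.Nonempty) (hTC : Set.MapsTo T C C) (hSC : Set.MapsTo S C C)
    (hT : ∀ x ∈ C, ∀ y ∈ C, ‖T x - T y‖ ≤ ‖x - y‖) (hτ0 : 0 ≤ τ) (hτ1 : τ < 1)
    (hS : ∀ x ∈ C, ∀ y ∈ C, ‖S x - S y‖ ≤ τ * ‖x - y‖) {t : ℝ} (ht0 : 0 < t) (ht1 : t ≤ 1) :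
    ∃ z ∈ C, z = (1 - t) • T z + t • S z := by
  have h1t : 0 ≤ 1 - t := by linarith
  refine exists_fixedPoint_of_contraction (f := fun z => (1 - t) • T z + t • S z) hC hne
    (fun x hx => hconv (hTC hx) (hSC hx) h1t ht0.le (by ring))
    (k := 1 - t + t * τ) (by positivity) (by nlinarith) fun x hx y hy => ?_
  have h1 : (1 - t) • T x + t • S x - ((1 - t) • T y + t • S y)
      = (1 - t) • (T x - T y) + t • (S x - S y) := by module
  calc ‖(1 - t) • T x + t • S x - ((1 - t) • T y + t • S y)‖
      ≤ (1 - t) * ‖T x - T y‖ + t * ‖S x - S y‖ := by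
        rw [h1]
        refine (norm_add_le _ _).trans_eq ?_
        rw [norm_smul_of_nonneg h1t, norm_smul_of_nonneg ht0.le]
    _ ≤ (1 - t) * ‖x - y‖ + t * (τ * ‖x - y‖) := by
        gcongr
        · exact hT x hx y hy
        · exact hS x hx y hy
    _ = (1 - t + t * τ) * ‖x - y‖ := by ring

/-- The resolvent `w = (1 - t) T w + t a` depends nonexpansively on its anchor `a`. -/
theorem norm_resolvent_sub_le (hT : ∀ x ∈ C, ∀ y ∈ C, ‖T x - T y‖ ≤ ‖x - y‖)
    {t : ℝ} (ht0 : 0 < t) (ht1 : t ≤ 1) {a b w z : H} (hw : w ∈ C) (hz : z ∈ C)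
    (hwt : w = (1 - t) • T w + t • a) (hzt : z = (1 - t) • T z + t • b) :
    ‖w - z‖ ≤ ‖a - b‖ := by
  have h1t : 0 ≤ 1 - t := by linarith
  have h1 : w - z = (1 - t) • (T w - T z) + t • (a - b) := by
    nth_rw 1 [hwt, hzt]; module
  have h2 : ‖w - z‖ ≤ (1 - t) * ‖w - z‖ + t * ‖a - b‖ := by
    calc ‖w - z‖ = ‖(1 - t) • (T w - T z) + t • (a - b)‖ := by rw [← h1]
      _ ≤ (1 - t) * ‖T w - T z‖ + t * ‖a - b‖ := by
        refine (norm_add_le _ _).trans_eq ?_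
        rw [norm_smul_of_nonneg h1t, norm_smul_of_nonneg ht0.le]
      _ ≤ _ := by gcongr; exact hT w hw z hz
  nlinarith

/-- `I - T` is monotone for a nonexpansive map `T`. -/
theorem inner_sub_map_sub_nonneg (hT : ∀ x ∈ C, ∀ y ∈ C, ‖T x - T y‖ ≤ ‖x - y‖) {x y : H}
    (hx : x ∈ C) (hy : y ∈ C) : 0 ≤ inner ℝ ((x - T x) - (y - T y)) (x - y) := by
  have h1 : (x - T x) - (y - T y) = (x - y) - (T x - T y) := by abel
  rw [h1, inner_sub_left, real_inner_self_eq_norm_sq]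
  nlinarith [real_inner_le_norm (T x - T y) (x - y), hT x hx y hy, norm_nonneg (x - y)]

/-- Along a resolvent curve with a fixed anchor `a`, the squared distance to `a` grows, as the
parameter decreases, by at least the squared distance travelled. -/
theorem norm_anchor_sub_sq_le (hT : ∀ x ∈ C, ∀ y ∈ C, ‖T x - T y‖ ≤ ‖x - y‖)
    {s t : ℝ} (hs0 : 0 < s) (hst : s ≤ t) (ht1 : t ≤ 1) {a v w : H} (hv : v ∈ C) (hw : w ∈ C)
    (hvs : v = (1 - s) • T v + s • a) (hwt : w = (1 - t) • T w + t • a) :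
    ‖a - w‖ ^ 2 + ‖w - v‖ ^ 2 ≤ ‖a - v‖ ^ 2 := by
  rcases hst.eq_or_lt with rfl | hlt
  · have h := norm_resolvent_sub_le hT hs0 ht1 hw hv hwt hvs
    rw [sub_self, norm_zero] at h
    have h0 : w = v := sub_eq_zero.1 (norm_le_zero_iff.1 h)
    simp [h0]
  · have h1 : (1 - s) • (v - T v) = s • (a - v) := by
      have : (1 - s) • T v = v - s • a := eq_sub_of_add_eq hvs.symm
      rw [smul_sub, this]; module
    have h2 : (1 - t) • (w - T w) = t • (a - w) := by
      have : (1 - t) • T w = w - t • a := eq_sub_of_add_eq hwt.symm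
      rw [smul_sub, this]; module
    have hmon := inner_sub_map_sub_nonneg hT hw hv
    have h3 : ((1 - t) * (1 - s)) • ((w - T w) - (v - T v))
        = (t - s) • (a - w) - ((1 - t) * s) • (w - v) := by
      have : ((1 - t) * (1 - s)) • ((w - T w) - (v - T v))
          = (1 - s) • ((1 - t) • (w - T w)) - (1 - t) • ((1 - s) • (v - T v)) := by module
      rw [this, h1, h2]; module
    have h4 : 0 ≤ (t - s) * inner ℝ (a - w) (w - v) - (1 - t) * s * ‖w - v‖ ^ 2 := by
      have h5 := mul_nonneg (mul_nonneg (sub_nonneg.2 ht1) (by linarith : 0 ≤ 1 - s)) hmon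
      rwa [← real_inner_smul_left, h3, inner_sub_left, real_inner_smul_left,
        real_inner_smul_left, real_inner_self_eq_norm_sq] at h5
    have h6 : 0 ≤ inner ℝ (a - w) (w - v) := by
      have : 0 ≤ (1 - t) * s * ‖w - v‖ ^ 2 :=
        mul_nonneg (mul_nonneg (by linarith) hs0.le) (sq_nonneg _)
      exact nonneg_of_mul_nonneg_right (by linarith) (sub_pos.2 hlt)
    have h7 : a - v = (a - w) + (w - v) := by abel
    rw [h7, norm_add_sq_real]
    linarith

/-- A real sequence that rises by at most `D ^ 2` over `n ≥ D ^ 2 / η ^ 2` steps has one step of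
size at most `η ^ 2`. -/
theorem exists_lt_sub_le {φ : ℕ → ℝ} (h0 : 0 ≤ φ 0) {D η : ℝ} (hη : 0 < η) {n : ℕ}
    (hn1 : 1 ≤ n) (hn : D ^ 2 / η ^ 2 ≤ n) (hD : φ n ≤ D ^ 2) :
    ∃ j < n, φ (j + 1) - φ j ≤ η ^ 2 := by
  by_contra! hcon
  have h1 : ∑ _j ∈ Finset.range n, η ^ 2 < ∑ j ∈ Finset.range n, (φ (j + 1) - φ j) :=
    Finset.sum_lt_sum_of_nonempty ⟨0, Finset.mem_range.2 hn1⟩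
      fun j hj => hcon j (Finset.mem_range.1 hj)
  rw [Finset.sum_range_sub, Finset.sum_const, Finset.card_range, nsmul_eq_mul] at h1
  rw [div_le_iff₀ (by positivity)] at hn
  linarith

/-- Metastability of a resolvent curve with a fixed anchor. -/
theorem exists_anchored_stable [CompleteSpace H] (hC : IsClosed C) (hconv : Convex ℝ C)
    (hTC : Set.MapsTo T C C) (hT : ∀ x ∈ C, ∀ y ∈ C, ‖T x - T y‖ ≤ ‖x - y‖)
    (hD : ∀ x ∈ C, ∀ y ∈ C, ‖x - y‖ ≤ D) {a : H} (ha : a ∈ C) {η : ℝ} (hη : 0 < η) {n : ℕ}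
    (hn1 : 1 ≤ n) (hn : D ^ 2 / η ^ 2 ≤ n) {t : ℕ → ℝ}
    (ht0 : ∀ j, 0 < t j) (ht1 : ∀ j, t j ≤ 1) :
    ∃ j < n, ∃ p ∈ C, ∀ s ∈ Set.Icc (t (j + 1)) (t j), ∀ w ∈ C,
      w = (1 - s) • T w + s • a → ‖w - p‖ ≤ η := by
  have hex : ∀ j, ∃ w ∈ C, w = (1 - t j) • T w + t j • a := fun j =>
    exists_resolvent (S := fun _ => a) hC hconv ⟨a, ha⟩ hTC (fun _ _ => ha) hT le_rfl one_pos
      (by simp) (ht0 j) (ht1 j)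
  choose w hwC hw using hex
  obtain ⟨j, hj, hle⟩ := exists_lt_sub_le (φ := fun j => ‖a - w j‖ ^ 2) (sq_nonneg _) hη hn1 hn
    (pow_le_pow_left₀ (norm_nonneg _) (hD a ha _ (hwC n)) 2)
  refine ⟨j, hj, w j, hwC j, fun s hs v hv hvs => ?_⟩
  have hs0 : 0 < s := (ht0 _).trans_le hs.1
  have h1 := norm_anchor_sub_sq_le hT hs0 hs.2 (ht1 j) hv (hwC j) hvs (hw j)
  have h2 := norm_anchor_sub_sq_le hT (ht0 (j + 1)) hs.1 (hs.2.trans (ht1 j)) (hwC _) hv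
    (hw _) hvs
  rw [norm_sub_rev]
  refine (sq_le_sq₀ (norm_nonneg _) hη.le).1 ?_
  linarith [sq_nonneg ‖v - w (j + 1)‖]

/-- Metastability of the viscosity curve `z = (1 - s) T z + s S z`. In a block of parameters on
which the curve stays within `r` of a point `p`, the curve is within `τ r` of the resolvent curve
anchored at `S p`, and the latter is `η`-stable on one of any `n` sub-blocks. So the radius
contracts by `τ` (up to `η`) at the price of a factor `n` in the number of blocks. -/
theorem exists_viscosity_stable [CompleteSpace H] (hC : IsClosed C) (hconv : Convex ℝ C)
    (hne : C.Nonempty) (hTC : Set.MapsTo T C C) (hSC : Set.MapsTo S C C)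
    (hT : ∀ x ∈ C, ∀ y ∈ C, ‖T x - T y‖ ≤ ‖x - y‖)
    (hD : ∀ x ∈ C, ∀ y ∈ C, ‖x - y‖ ≤ D) (hτ0 : 0 ≤ τ) (hτ1 : τ < 1)
    (hS : ∀ x ∈ C, ∀ y ∈ C, ‖S x - S y‖ ≤ τ * ‖x - y‖) {η : ℝ} (hη : 0 < η) {n : ℕ}
    (hn1 : 1 ≤ n) (hn : D ^ 2 / η ^ 2 ≤ n) (i : ℕ) {t : ℕ → ℝ} (ht : Antitone t)
    (ht0 : ∀ j, 0 < t j) (ht1 : ∀ j, t j ≤ 1) :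
    ∃ j < n ^ i, ∃ p ∈ C, ∀ s ∈ Set.Icc (t (j + 1)) (t j), ∀ z ∈ C,
      z = (1 - s) • T z + s • S z → ‖z - p‖ ≤ τ ^ i * D + η / (1 - τ) := by
  have hp : 0 < 1 - τ := by linarith
  induction i generalizing t with
  | zero =>
    obtain ⟨p, hpC⟩ := hne
    refine ⟨0, by simp, p, hpC, fun s _ z hz _ => ?_⟩
    have := hD z hz p hpC
    have : 0 ≤ η / (1 - τ) := by positivity
    simp only [pow_zero, one_mul]
    linarith
  | succ i ih =>
    obtain ⟨j, hj, p, hpC, hjp⟩ := ih (t := fun k => t (n * k))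
      (fun a b hab => ht (Nat.mul_le_mul_left n hab)) (fun _ => ht0 _) (fun _ => ht1 _)
    obtain ⟨k, hk, q, hqC, hkq⟩ := exists_anchored_stable hC hconv hTC hT hD (hSC hpC) hη hn1 hn
      (t := fun k => t (n * j + k)) (fun _ => ht0 _) (fun _ => ht1 _)
    refine ⟨n * j + k, ?_, q, hqC, fun s hs z hz hzs => ?_⟩
    · calc n * j + k < n * j + n := by omega
        _ = n * (j + 1) := by ring
        _ ≤ n * n ^ i := Nat.mul_le_mul_left n hj
        _ = n ^ (i + 1) := (pow_succ' n i).symm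
    · have hs0 : 0 < s := (ht0 _).trans_le hs.1
      have hs1 : s ≤ 1 := hs.2.trans (ht1 _)
      have h1 := hjp s ⟨(ht (by nlinarith)).trans hs.1, hs.2.trans (ht (by omega))⟩ z hz hzs
      obtain ⟨w, hwC, hw⟩ := exists_resolvent (S := fun _ => S p) hC hconv hne hTC
        (fun _ _ => hSC hpC) hT le_rfl one_pos (by simp) hs0 hs1
      have h2 := hkq s hs w hwC hw
      have h3 := norm_resolvent_sub_le hT hs0 hs1 hz hwC hzs hw
      have h4 := hS z hz p hpC
      have h5 := mul_le_mul_of_nonneg_left h1 hτ0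
      have h6 := norm_sub_le_norm_sub_add_norm_sub z w q
      have h7 : τ * (τ ^ i * D + η / (1 - τ)) + η = τ ^ (i + 1) * D + η / (1 - τ) := by
        field_simp; ring
      linarith

/-- The viscosity curve depends on its parameter with modulus of order `|s - t| / t`. -/
theorem norm_viscosity_sub_le (hTC : Set.MapsTo T C C) (hSC : Set.MapsTo S C C)
    (hT : ∀ x ∈ C, ∀ y ∈ C, ‖T x - T y‖ ≤ ‖x - y‖)
    (hD : ∀ x ∈ C, ∀ y ∈ C, ‖x - y‖ ≤ D)
    (hS : ∀ x ∈ C, ∀ y ∈ C, ‖S x - S y‖ ≤ τ * ‖x - y‖) {s t : ℝ} (ht0 : 0 < t) (ht1 : t ≤ 1)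
    {y z : H} (hy : y ∈ C) (hz : z ∈ C)
    (hys : y = (1 - s) • T y + s • S y) (hzt : z = (1 - t) • T z + t • S z) :
    (1 - τ) * t * ‖y - z‖ ≤ |s - t| * D := by
  have h1t : 0 ≤ 1 - t := by linarith
  have h1 : y - z = (1 - t) • (T y - T z) + t • (S y - S z) + (s - t) • (S y - T y) := by
    nth_rw 1 [hys, hzt]; module
  have h2 : ‖y - z‖ ≤ (1 - t) * ‖y - z‖ + t * (τ * ‖y - z‖) + |s - t| * D := by
    calc ‖y - z‖ = ‖(1 - t) • (T y - T z) + t • (S y - S z) + (s - t) • (S y - T y)‖ := by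
          rw [← h1]
      _ ≤ (1 - t) * ‖T y - T z‖ + t * ‖S y - S z‖ + |s - t| * ‖S y - T y‖ := by
        refine norm_add₃_le.trans_eq ?_
        rw [norm_smul_of_nonneg h1t, norm_smul_of_nonneg ht0.le, norm_smul, Real.norm_eq_abs]
      _ ≤ _ := by
        gcongr
        · exact hT y hy z hz
        · exact hS y hy z hz
        · exact hD _ (hSC hy) _ (hTC hy)
  linarith

/-- On the viscosity curve the variational inequality holds up to an error that is controlled by
the parameter `t` and the residual `ν` of the test point. -/
theorem inner_viscosity_le (hTC : Set.MapsTo T C C) {G : H → H} (hGC : Set.MapsTo G C C)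
    (hT : ∀ x ∈ C, ∀ y ∈ C, ‖T x - T y‖ ≤ ‖x - y‖)
    (hD : ∀ x ∈ C, ∀ y ∈ C, ‖x - y‖ ≤ D) (hτ1 : τ ≤ 1)
    (hG : ∀ x ∈ C, ∀ y ∈ C, ‖G x - G y‖ ≤ τ * ‖x - y‖) {t : ℝ} (ht0 : 0 < t) (ht1 : t ≤ 1)
    {x z : H} (hx : x ∈ C) (hz : z ∈ C) (hzt : z = (1 - t) • T z + t • G (T z)) {ν : ℝ}
    (hν : ‖T x - x‖ ≤ ν) :
    inner ℝ (G z - z) (x - z) ≤ ν * D / t + t * D ^ 2 := by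
  have hD0 : 0 ≤ D := (norm_nonneg _).trans (hD z hz z hz)
  have hν0 : 0 ≤ ν := (norm_nonneg _).trans hν
  have hmon := inner_sub_map_sub_nonneg hT hz hx
  have h1 : (1 - t) • (z - T z) = t • (G (T z) - z) := by
    have : (1 - t) • T z = z - t • G (T z) := eq_sub_of_add_eq hzt.symm
    rw [smul_sub, this]; module
  have h2 : t * inner ℝ (G (T z) - z) (x - z) ≤ ν * D := by
    have h3 : t * inner ℝ (G (T z) - z) (x - z)
        = (1 - t) * (inner ℝ (T x - x) (z - x)
          - inner ℝ ((z - T z) - (x - T x)) (z - x)) := by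
      rw [← real_inner_smul_left, ← h1, real_inner_smul_left, ← inner_sub_left,
        ← neg_sub z x, inner_neg_right, ← inner_neg_left]
      congr 2
      abel
    have h4 : inner ℝ (T x - x) (z - x) ≤ ν * D :=
      (real_inner_le_norm _ _).trans
        (mul_le_mul hν (hD z hz x hx) (norm_nonneg _) hν0)
    have h5 : 0 ≤ ν * D := by positivity
    rw [h3]
    nlinarith
  have h6 : inner ℝ (G (T z) - z) (x - z) ≤ ν * D / t := by
    rw [le_div_iff₀ ht0]; linarith
  have h7 : ‖G z - G (T z)‖ ≤ t * D := by
    have h8 : z - T z = t • (G (T z) - T z) := by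
      nth_rw 1 [hzt]; module
    have h9 : ‖z - T z‖ ≤ t * D := by
      rw [h8, norm_smul_of_nonneg ht0.le]
      gcongr
      exact hD _ (hGC (hTC hz)) _ (hTC hz)
    refine (hG z hz _ (hTC hz)).trans ?_
    nlinarith [norm_nonneg (z - T z)]
  have h10 : inner ℝ (G z - G (T z)) (x - z) ≤ t * D * D :=
    (real_inner_le_norm _ _).trans
      (mul_le_mul h7 (hD x hx z hz) (norm_nonneg _) (by positivity))
  have h11 : G z - z = (G (T z) - z) + (G z - G (T z)) := by abel
  rw [h11, inner_add_left]
  nlinarith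

/-- The variational expression is Lipschitz in the base point. -/
theorem inner_map_sub_le {G : H → H} (hGC : Set.MapsTo G C C)
    (hD : ∀ x ∈ C, ∀ y ∈ C, ‖x - y‖ ≤ D) (hτ0 : 0 ≤ τ)
    (hG : ∀ x ∈ C, ∀ y ∈ C, ‖G x - G y‖ ≤ τ * ‖x - y‖) {x y z : H} (hx : x ∈ C) (hy : y ∈ C)
    (hz : z ∈ C) :
    inner ℝ (G y - y) (x - y) ≤ inner ℝ (G z - z) (x - z) + (2 + τ) * D * ‖y - z‖ := by
  have hD0 : 0 ≤ D := (norm_nonneg _).trans (hD z hz z hz)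
  have h1 : inner ℝ (G y - y) (x - y) = inner ℝ (G z - z) (x - z)
      + (inner ℝ ((G y - G z) - (y - z)) (x - y) + inner ℝ (G z - z) (z - y)) := by
    simp only [inner_sub_left, inner_sub_right]; ring
  have h2 : ‖(G y - G z) - (y - z)‖ ≤ (τ + 1) * ‖y - z‖ := by
    have := hG y hy z hz
    have := norm_sub_le (G y - G z) (y - z)
    linarith
  have h3 : inner ℝ ((G y - G z) - (y - z)) (x - y) ≤ (τ + 1) * ‖y - z‖ * D :=
    (real_inner_le_norm _ _).trans
      (mul_le_mul h2 (hD x hx y hy) (norm_nonneg _) (by positivity))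
  have h4 : inner ℝ (G z - z) (z - y) ≤ D * ‖y - z‖ := by
    refine (real_inner_le_norm _ _).trans ?_
    rw [norm_sub_rev z y]
    exact mul_le_mul_of_nonneg_right (hD _ (hGC hz) _ hz) (norm_nonneg _)
  rw [h1]
  linarith

end Resolvents

/-! ### The iteration follows the viscosity curve -/

section Tracking

/-- Solution of the recursive inequality `a' ≤ (1 - θ λ) a + θ λ b`. -/
theorem le_add_exp_of_recursion {a lam : ℕ → ℝ} {θ b D : ℝ} (hθ0 : 0 ≤ θ) (hθ1 : θ ≤ 1)
    (hlam : ∀ n, 0 < lam n ∧ lam n ≤ 1) (hD : 0 ≤ D) {M : ℕ} (hM : a M ≤ b + D)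
    (hrec : ∀ n, M ≤ n → a (n + 1) ≤ (1 - θ * lam (n + 1)) * a n + θ * lam (n + 1) * b)
    {n : ℕ} (hn : M ≤ n) :
    a n ≤ b + D * Real.exp (-(θ * ∑ i ∈ Finset.Ioc M n, lam i)) := by
  induction n, hn using Nat.le_induction with
  | base => simpa using hM
  | succ n hn ih =>
    obtain ⟨h0, h1⟩ := hlam (n + 1)
    have h2 : 0 ≤ 1 - θ * lam (n + 1) := by nlinarith
    have h3 : 1 - θ * lam (n + 1) ≤ Real.exp (-(θ * lam (n + 1))) := by
      have := Real.add_one_le_exp (-(θ * lam (n + 1)))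
      linarith
    set E := Real.exp (-(θ * ∑ i ∈ Finset.Ioc M n, lam i)) with hE
    have hE0 : 0 ≤ D * E := mul_nonneg hD (Real.exp_pos _).le
    rw [Finset.sum_Ioc_succ_top (by omega), mul_add, neg_add, Real.exp_add, ← hE]
    have h4 := mul_le_mul_of_nonneg_left ih h2
    have h5 := mul_le_mul_of_nonneg_right h3 hE0
    linarith [hrec n hn]

/-- The exponential factor `exp (-(1 - τ) ∑ λ)` is small once the partial sum reaches
`(M + L) / (1 - τ)`: the first `M` terms contribute at most `M`, because `λ ≤ 1`. -/
theorem exp_sum_Ioc_le {lam : ℕ → ℝ} (hlam : ∀ n, 0 < lam n ∧ lam n ≤ 1) {τ : ℝ}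
    (hτ0 : 0 < τ) (hτ1 : τ < 1) {L : ℝ} (hL : 0 ≤ L) {M n : ℕ}
    (hsum : (M + L) / (1 - τ) ≤ ∑ i ∈ Finset.Icc 1 n, lam i) :
    M ≤ n ∧ Real.exp (-((1 - τ) * ∑ i ∈ Finset.Ioc M n, lam i)) ≤ Real.exp (-L) := by
  have hp : 0 < 1 - τ := by linarith
  have hIcc : ∀ k, Finset.Icc 1 k = Finset.Ioc 0 k := fun k => by
    ext i; simp [Nat.succ_le_iff]
  have hle : ∀ k : ℕ, ∑ i ∈ Finset.Ioc 0 k, lam i ≤ k := fun k => by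
    have := Finset.sum_le_card_nsmul (Finset.Ioc 0 k) lam 1 fun i _ => (hlam i).2
    simpa using this
  rw [hIcc, div_le_iff₀ hp] at hsum
  have hM0 : (0 : ℝ) ≤ M := Nat.cast_nonneg M
  have hMn : M ≤ n := by
    have h1 := hle n
    have h2 : 0 ≤ ∑ i ∈ Finset.Ioc 0 n, lam i := Finset.sum_nonneg fun i _ => (hlam i).1.le
    have h3 : (M : ℝ) ≤ n := by nlinarith
    exact_mod_cast h3
  refine ⟨hMn, Real.exp_le_exp.2 (neg_le_neg ?_)⟩
  have h1 := Finset.sum_Ioc_consecutive lam (Nat.zero_le M) hMn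
  have h2 := hle M
  nlinarith

variable {H : Type*} [NormedAddCommGroup H] [InnerProductSpace ℝ H]
  {C : Set H} {T S : H → H} {τ D : ℝ}

/-- One step of the iteration brings it closer to the viscosity curve. -/
theorem norm_step_sub_le (hTC : Set.MapsTo T C C) (hSC : Set.MapsTo S C C)
    (hT : ∀ x ∈ C, ∀ y ∈ C, ‖T x - T y‖ ≤ ‖x - y‖)
    (hD : ∀ x ∈ C, ∀ y ∈ C, ‖x - y‖ ≤ D) (hτ1 : τ < 1)
    (hS : ∀ x ∈ C, ∀ y ∈ C, ‖S x - S y‖ ≤ τ * ‖x - y‖) {s t η : ℝ} (ht0 : 0 < t) (ht1 : t ≤ 1)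
    (hτ0 : 0 ≤ τ) (hst : |s - t| / t ^ 2 ≤ η)
    {v y z : H} (hv : v ∈ C) (hy : y ∈ C) (hz : z ∈ C)
    (hys : y = (1 - s) • T y + s • S y) (hzt : z = (1 - t) • T z + t • S z) :
    ‖(1 - t) • T v + t • S v - z‖
      ≤ (1 - (1 - τ) * t) * ‖v - y‖ + (1 - τ) * t * (η * D / (1 - τ) ^ 2) := by
  have hp : 0 < 1 - τ := by linarith
  have h1t : 0 ≤ 1 - t := by linarith
  have hD0 : 0 ≤ D := (norm_nonneg _).trans (hD z hz z hz)
  have h1 : (1 - t) • T v + t • S v - z = (1 - t) • (T v - T z) + t • (S v - S z) := by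
    nth_rw 1 [hzt]; module
  have h2 : ‖(1 - t) • T v + t • S v - z‖ ≤ (1 - (1 - τ) * t) * ‖v - z‖ := by
    calc ‖(1 - t) • T v + t • S v - z‖ ≤ (1 - t) * ‖T v - T z‖ + t * ‖S v - S z‖ := by
          rw [h1]
          refine (norm_add_le _ _).trans_eq ?_
          rw [norm_smul_of_nonneg h1t, norm_smul_of_nonneg ht0.le]
      _ ≤ (1 - t) * ‖v - z‖ + t * (τ * ‖v - z‖) := by
          gcongr
          · exact hT v hv z hz
          · exact hS v hv z hz
      _ = _ := by ring
  have h3 := norm_viscosity_sub_le hTC hSC hT hD hS ht0 ht1 hy hz hys hzt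
  have h4 : ‖y - z‖ ≤ (1 - τ) * t * (η * D / (1 - τ) ^ 2) := by
    rw [div_le_iff₀ (by positivity)] at hst
    have h5 : (1 - τ) * t * ‖y - z‖ ≤ (1 - τ) * t * ((1 - τ) * t * (η * D / (1 - τ) ^ 2)) := by
      calc (1 - τ) * t * ‖y - z‖ ≤ η * t ^ 2 * D := h3.trans (by gcongr)
        _ = _ := by field_simp
    exact le_of_mul_le_mul_left h5 (by positivity)
  have h6 : 0 ≤ 1 - (1 - τ) * t := by nlinarith
  have h7 := norm_sub_le_norm_sub_add_norm_sub v y z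
  have h8 : 0 ≤ (1 - τ) * t := by positivity
  nlinarith [norm_nonneg (y - z), norm_nonneg (v - y)]

end Tracking

end HSDM

/-! ### The rate of metastability -/

theorem theorem6 {H : Type*} [NormedAddCommGroup H] [InnerProductSpace ℝ H] [CompleteSpace H]
    (d : ℕ) (hd : 0 < d)
    (C : Set H) (hCclosed : IsClosed C) (hCconv : Convex ℝ C)
    (hCbdd : Bornology.IsBounded C) (hCdiam : Metric.diam C ≤ d)
    (T G : H → H) (hTC : Set.MapsTo T C C) (hGC : Set.MapsTo G C C)
    (hT : ∀ x ∈ C, ∀ y ∈ C, ‖T x - T y‖ ≤ ‖x - y‖)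
    (τ : ℝ) (hτ0 : 0 < τ) (hτ1 : τ < 1)
    (hG : ∀ x ∈ C, ∀ y ∈ C, ‖G x - G y‖ ≤ τ * ‖x - y‖)
    (lam : ℕ → ℝ) (hlam : ∀ n, 0 < lam n ∧ lam n ≤ 1)
    (h : ℕ → ℕ) (hh : ∀ n, 0 < h n ∧ 1 / (h n : ℝ) ≤ lam n)
    (χ : ℕ → ℕ) (hχ : ∀ n i : ℕ, χ n ≤ i → lam i ≤ 1 / ((n : ℝ) + 1))
    (φ₁ φ₂ : ℝ → ℕ)
    (hφ₁ : ∀ k : ℝ, 0 < k → k ≤ ∑ i ∈ Finset.Icc 1 (φ₁ k), lam i)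
    (hφ₂ : ∀ η : ℝ, 0 < η → ∀ n : ℕ, φ₂ η ≤ n →
      |lam n - lam (n + 1)| / lam (n + 1) ^ 2 ≤ η)
    (u : ℕ → H) (hu0 : u 0 ∈ C)
    (hu : ∀ n, u (n + 1) = (1 - lam (n + 1)) • T (u n) + lam (n + 1) • G (T (u n)))
    (ε : ℝ) (hε0 : 0 < ε) (hε1 : ε ≤ 1) (g : ℕ → ℕ)
    (δ : ℝ) (hδ : δ = HSDM.delta ε τ d)
    (c : ℕ) (hc : c = HSDM.cShift ε τ φ₁ φ₂ d)
    (ε' : ℝ) (hε' : ε' = 1 / (HSDM.kFinal (δ / 6) τ (HSDM.gShift g c) χ h d : ℝ)) :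
    0 < ε' ∧
    ∃ n : ℕ, n ≤ HSDM.Xi (δ / 6) τ (HSDM.gShift g c) χ h d + c ∧
      (∀ i ∈ Set.Icc n (n + g n), ∀ j ∈ Set.Icc n (n + g n), ‖u i - u j‖ ≤ ε) ∧
      (∀ x ∈ C, ‖T x - x‖ ≤ ε' → inner ℝ (G (u n) - u n) (x - u n) ≤ ε) := by
  open HSDM in
  have hp : 0 < 1 - τ := by linarith
  have hd1 : (1 : ℝ) ≤ d := by exact_mod_cast hd
  have hd0 : (0 : ℝ) < d := by linarith
  have hD : ∀ x ∈ C, ∀ y ∈ C, ‖x - y‖ ≤ (d : ℝ) := fun x hx y hy => by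
    rw [← dist_eq_norm]
    exact (Metric.dist_le_diam_of_mem hCbdd hx hy).trans hCdiam
  have hδmul : (2 + τ) * d * δ = ε / 2 := by
    rw [hδ, delta]; field_simp
  have hδ0 : 0 < δ := by rw [hδ, delta]; positivity
  have hδε : δ ≤ ε / 4 := by nlinarith [mul_le_mul_of_nonneg_right hd1 hδ0.le, mul_pos hτ0 hd0]
  set e : ℝ := δ / 6 with he
  have he0 : 0 < e := by positivity
  have he1 : e ≤ 1 := by rw [he]; linarith
  -- the viscosity curve at the parameters `lam n`
  set S : H → H := fun x => G (T x)
  have hSC : Set.MapsTo S C C := fun x hx => hGC (hTC hx)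
  have hS : ∀ x ∈ C, ∀ y ∈ C, ‖S x - S y‖ ≤ τ * ‖x - y‖ := fun x hx y hy =>
    (hG _ (hTC hx) _ (hTC hy)).trans (mul_le_mul_of_nonneg_left (hT x hx y hy) hτ0.le)
  have hex : ∀ n, ∃ z ∈ C, z = (1 - lam n) • T z + lam n • S z := fun n =>
    exists_resolvent hCclosed hCconv ⟨_, hu0⟩ hTC hSC hT hτ0.le hτ1 hS (hlam n).1 (hlam n).2
  choose z hzC hz using hex
  have huC : ∀ n, u n ∈ C := fun n => by
    induction n with
    | zero => exact hu0
    | succ n ih =>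
      rw [hu]
      exact hCconv (hTC ih) (hSC ih) (sub_nonneg.2 (hlam _).2) (hlam _).1.le (by ring)
  -- the iteration follows the curve from index `c` on
  have htrack : ∀ n, c ≤ n → ‖u n - z n‖ ≤ δ / 3 := fun n hn => by
    set η : ℝ := (1 - τ) ^ 2 * δ / (6 * d) with hη
    have hη0 : 0 < η := by positivity
    have hηb : η * d / (1 - τ) ^ 2 = δ / 6 := by rw [hη]; field_simp
    have hL : 0 < Real.log (6 * d / δ) := Real.log_pos (by
      rw [one_lt_div hδ0]; linarith)
    have hsum := hφ₁ ((φ₂ η + Real.log (6 * d / δ)) / (1 - τ)) (by positivity)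
    have hc' : c = φ₁ ((φ₂ η + Real.log (6 * d / δ)) / (1 - τ)) := by
      rw [hc, cShift, ← hδ]
    rw [← hc'] at hsum
    have hsum' := hsum.trans (Finset.sum_le_sum_of_subset_of_nonneg
      (Finset.Icc_subset_Icc_right hn) fun i _ _ => (hlam i).1.le)
    obtain ⟨hMn, hexp⟩ := exp_sum_Ioc_le hlam hτ0 hτ1 hL.le hsum'
    have hrec := le_add_exp_of_recursion (a := fun n => ‖u n - z n‖) (b := δ / 6) (D := d)
      hp.le (by linarith) hlam hd0.le (M := φ₂ η)
      (by have := hD _ (huC (φ₂ η)) _ (hzC (φ₂ η)); linarith)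
      (fun k hk => by
        have := norm_step_sub_le hTC hSC hT hD hτ1 hS (hlam (k + 1)).1 (hlam (k + 1)).2 hτ0.le
          (hφ₂ η hη0 k hk) (huC k) (hzC k) (hzC (k + 1)) (hz k) (hz (k + 1))
        rw [hηb] at this
        simp only [hu k]
        exact this) hMn
    rw [Real.exp_neg (Real.log _), Real.exp_log (by positivity)] at hexp
    have : d * Real.exp (-((1 - τ) * ∑ i ∈ Finset.Ioc (φ₂ η) n, lam i)) ≤ δ / 6 := calc
      _ ≤ d * (6 * d / δ)⁻¹ := by gcongr
      _ = δ / 6 := by field_simp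
    linarith
  -- The blocks of parameters are `[1 / m (j + 1), 1 / m j]`. All parameters `lam i` with `i`
  -- between `χ (d * m j)` and `g̃ (χ (d * m j))` lie in one block, since `f (m j) ≤ m (j + 1)`.
  set f := fBase e τ (gShift g c) χ h d
  set K := kFinal e τ (gShift g c) χ h d
  set N := ⌈(d : ℝ) ^ 2 / ((1 - τ) * e / 4) ^ 2⌉₊
  have hN1 : 1 ≤ N := Nat.ceil_pos.2 (by positivity)
  set m : ℕ → ℕ := fun j => (tilde d f)^[j + 1] 1 with hm
  have hm_mono : Monotone m := fun a b hab => iterate_tilde_mono hd f 1 (Nat.succ_le_succ hab)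
  have hm1 : ∀ j, 1 ≤ m j := fun j => (le_tilde hd f 1).trans (hm_mono (Nat.zero_le j))
  have hmpos : ∀ j, (0 : ℝ) < m j := fun j => by exact_mod_cast hm1 j
  have hfm : ∀ j, f (m j) ≤ m (j + 1) := fun j => by
    simp only [hm]
    rw [Function.iterate_succ_apply' _ (j + 1)]
    exact apply_le_tilde hd f (hm1 j)
  have hmK : ∀ j ≤ N ^ (iZero e τ d + 1), m j ≤ K := fun j hj =>
    (hm_mono hj).trans
      (iterate_tilde_le_kSeq hd hN1 (sq_ceil_succ_le_nTilde he0 he1 hτ0 hτ1 hd) f _)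
  have hK0 : (0 : ℝ) < K := by
    exact_mod_cast (hm1 0).trans (hmK 0 (Nat.zero_le _))
  refine ⟨hε' ▸ one_div_pos.2 hK0, ?_⟩
  obtain ⟨j, hj, p, -, hstab⟩ := exists_viscosity_stable hCclosed hCconv ⟨_, hu0⟩ hTC hSC hT hD
    hτ0.le hτ1 hS (η := (1 - τ) * e / 4) (by positivity) hN1 (Nat.le_ceil _) (iZero e τ d + 1)
    (t := fun j => 1 / (m j : ℝ))
    (fun a b hab => one_div_le_one_div_of_le (hmpos a) (by exact_mod_cast hm_mono hab))
    (fun j => one_div_pos.2 (hmpos j))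
    (fun j => by rw [div_le_one (hmpos j)]; exact_mod_cast hm1 j)
  have hrad : τ ^ (iZero e τ d + 1) * d + (1 - τ) * e / 4 / (1 - τ) ≤ e / 2 := by
    have h1 := pow_iZero_succ_mul_le he0 he1 hτ0 hτ1 hd
    have h2 : (1 - τ) * e / 4 / (1 - τ) = e / 4 := by field_simp
    linarith
  -- `χ` need not be monotone, so `χ (d * m j)` may exceed `χ (d * K)`. The least value of `χ` on
  -- `[d * m j, ∞)` does not, and it still forces `lam i ≤ 1 / (d * m j)`.
  obtain ⟨r, hr, hrmin⟩ : ∃ r, d * m j ≤ r ∧ ∀ q, d * m j ≤ q → χ r ≤ χ q := by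
    obtain ⟨r, hr, hr'⟩ := Nat.sInf_mem (s := χ '' Set.Ici (d * m j)) ⟨_, _, Set.self_mem_Ici, rfl⟩
    exact ⟨r, hr, fun q hq => hr' ▸ Nat.sInf_le ⟨q, hq, rfl⟩⟩
  have hlam_le : ∀ i, χ r ≤ i → lam i ≤ 1 / (d * m j) := fun i hi => by
    refine (hχ r i hi).trans (one_div_le_one_div_of_le (mul_pos hd0 (hmpos j)) ?_)
    have : ((d * m j : ℕ) : ℝ) ≤ r := by exact_mod_cast hr
    push_cast at this
    linarith
  have hh_le : ∀ i, i ≤ χ r + c + g (χ r + c) →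
      6 * d * (h i : ℝ) / ((1 - τ) * (e / 2) ^ 2) ≤ m (j + 1) := fun i hi =>
    (le_fBase he0 hτ1 (gShift g c) χ h (hrmin _ le_rfl)
      (hi.trans (le_max_right _ _))).trans (by exact_mod_cast hfm j)
  have hlam_inv : ∀ i, 1 ≤ lam i * h i := fun i => by
    have := (hh i).2
    rwa [div_le_iff₀ (by exact_mod_cast (hh i).1)] at this
  have hsmall : (1 - τ) * (e / 2) ^ 2 ≤ 1 := by
    have : (e / 2) ^ 2 ≤ 1 := pow_le_one₀ (by positivity) (by linarith)
    exact mul_le_one₀ (by linarith) (by positivity) this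
  have hzp : ∀ i ∈ Set.Icc (χ r + c) (χ r + c + g (χ r + c)), ‖z i - p‖ ≤ e / 2 := by
    intro i hi
    refine (hstab (lam i) ⟨?_, ?_⟩ (z i) (hzC i) (hz i)).trans hrad
    · have h1 := hh_le i hi.2
      rw [div_le_iff₀ (by positivity)] at h1
      have hhm : (h i : ℝ) ≤ m (j + 1) := by
        have h2 : (m (j + 1) : ℝ) * ((1 - τ) * (e / 2) ^ 2) ≤ m (j + 1) :=
          mul_le_of_le_one_right (hmpos _).le hsmall
        have h3 : (h i : ℝ) ≤ d * h i := le_mul_of_one_le_left (Nat.cast_nonneg _) hd1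
        have : (0 : ℝ) ≤ h i := Nat.cast_nonneg _
        nlinarith
      exact (one_div_le_one_div_of_le (by exact_mod_cast (hh i).1) hhm).trans (hh i).2
    · refine (hlam_le i (by have := hi.1; omega)).trans
        (one_div_le_one_div_of_le (hmpos j) ?_)
      exact le_mul_of_one_le_left (hmpos j).le hd1
  refine ⟨χ r + c, Nat.add_le_add_right (hrmin _ (Nat.mul_le_mul_left d (hmK j hj.le))) c,
    fun i hi k hk => ?_, fun x hx hTx => ?_⟩
  · have h1 := htrack i (by have := hi.1; omega)
    have h2 := htrack k (by have := hk.1; omega)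
    have h3 := hzp i hi
    have h4 := hzp k hk
    have h5 := norm_sub_le_norm_sub_add_norm_sub (u i) (z i) (u k)
    have h6 := norm_sub_le_norm_sub_add_norm_sub (z i) p (u k)
    have h7 := norm_sub_le_norm_sub_add_norm_sub p (z k) (u k)
    rw [norm_sub_rev p (z k)] at h7
    rw [norm_sub_rev (z k) (u k)] at h7
    linarith
  · set n := χ r + c with hn
    obtain ⟨hl0, hl1⟩ := hlam n
    have h1 := inner_map_sub_le hGC hD hτ0.le hG hx (huC n) (hzC n)
    have h2 := inner_viscosity_le hTC hGC hT hD hτ1.le hG hl0 hl1 hx (hzC n) (hz n) hTx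
    have h3 : (2 + τ) * d * ‖u n - z n‖ ≤ ε / 6 := by
      calc (2 + τ) * d * ‖u n - z n‖ ≤ (2 + τ) * d * (δ / 3) := by
            gcongr
            exact htrack n (by omega)
        _ = ε / 6 := by linarith
    set q : ℝ := (1 - τ) * (e / 2) ^ 2 with hq
    have hq0 : 0 < q := by positivity
    have hqε : q ≤ ε / 24 := by
      have : (e / 2) ^ 2 ≤ e / 2 := pow_le_of_le_one (by positivity) (by linarith) two_ne_zero
      have : q ≤ 1 * (e / 2) := mul_le_mul (by linarith) this (by positivity) zero_le_one
      linarith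
    -- `m j ≥ m 0 ≥ f 1` is large because `h ≥ 1`
    have h4 : lam n * (d : ℝ) ^ 2 ≤ q := by
      have hf1 := le_fBase (d := d) he0 hτ1 (gShift g c) χ h (m := 1) le_rfl (le_max_left _ _)
      have hf2 : (f 1 : ℝ) ≤ m j := by
        exact_mod_cast (apply_le_tilde hd f le_rfl).trans (hm_mono (Nat.zero_le j))
      have hh1 : (1 : ℝ) ≤ h (χ (d * 1)) := by exact_mod_cast (hh _).1
      have h6 : (d : ℝ) / q ≤ m j := by
        refine le_trans ?_ (hf1.trans hf2)
        gcongr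
        nlinarith
      rw [div_le_iff₀ hq0] at h6
      calc lam n * (d : ℝ) ^ 2 ≤ 1 / (d * m j) * (d : ℝ) ^ 2 := by
            gcongr
            exact hlam_le n (by omega)
        _ = (d : ℝ) / m j := by field_simp
        _ ≤ q := by rw [div_le_iff₀ (hmpos j)]; linarith
    have h5 : ε' * d / lam n ≤ q := by
      have h6 := (hh_le n (by omega)).trans (Nat.cast_le.2 (hmK (j + 1) hj))
      rw [div_le_iff₀ hq0] at h6
      have h7 := hlam_inv n
      rw [div_le_iff₀ hl0, hε', div_mul_eq_mul_div, one_mul, div_le_iff₀ hK0]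
      calc (d : ℝ) ≤ d * (lam n * h n) := le_mul_of_one_le_right hd0.le h7
        _ = lam n * (d * h n) := by ring
        _ ≤ lam n * (K * q) := by
          have h8 : 0 ≤ (d : ℝ) * h n := by positivity
          exact mul_le_mul_of_nonneg_left (by linarith) hl0.le
        _ = q * lam n * K := by ring
    linarith
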